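/- Let $X$ be a topological space equipped with its Borel $\sigma$-field, let $Y$ be a measurable space, let $\mu$ and $\nu$ be probability measures on $X$ and $Y$, and let $p:X\times Y\to(0,\infty)$ be jointly measurable, positive everywhere and bounded. Suppose that there is a nonempty compact set $K\subset X$ such that (a) for every $y\in Y$ the function $p(\cdot,y)$ is continuous on $K$; (b) there are finitely many points $x_1,\dots,x_J\in X$ and constants $c_1,\dots,c_J>0$ with $$\sup_{x\in K}p(x,y)\le\sum_{j=1}^{J}c_j\,p(x_j,y)\qquad\text{for all }y\in Y.$$ Then the Schrödinger system $$\mathsf a(dx)\int_Y p(x,y)\,\mathsf b(dy)=\mu(dx),\qquad \mathsf b(dy)\int_X p(x,y)\,\mathsf a(dx)=\nu(dy),$$ whose unknowns are $\sigma$-finite nonnegative measures $\mathsf a$ on $X$ and $\mathsf b$ on $Y$, admits a solution, and this solution is unique up to the transformations $(\mathsf a,\mathsf b)\mapsto(\kappa^{-1}\mathsf a,\kappa\,\mathsf b)$ with $\kappa>0$: any two solutions $(\mathsf a,\mathsf b)$ and $(\mathsf a',\mathsf b')$ satisfy $\mathsf a'=\kappa^{-1}\mathsf a$ and $\mathsf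 b'=\kappa\,\mathsf b$ for some $\kappa>0$. In particular, exactly one measure $\pi$ on $X\times Y$ is of the form $\pi(dx\,dy)=p(x,y)\,\mathsf a(dx)\,\mathsf b(dy)$ for a solution $(\mathsf a,\mathsf b)$. -/

import Mathlib

open MeasureTheory
open scoped ENNReal NNReal

/-- `(a, b)` solves the Schrödinger system with transition density `p` and marginals `μ`, `ν`:
`a` and `b` are σ-finite nonnegative measures with
`a(dx) ∫ p(x,y) b(dy) = μ(dx)` and `b(dy) ∫ p(x,y) a(dx) = ν(dy)` as measures. -/
structure IsSchrodingerSolution {X Y : Type*} [MeasurableSpace X] [MeasurableSpace Y]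
    (p : X → Y → ℝ) (μ : Measure X) (ν : Measure Y) (a : Measure X) (b : Measure Y) : Prop where
  sigmaFinite_left : SigmaFinite a
  sigmaFinite_right : SigmaFinite b
  left_eq : a.withDensity (fun x => ∫⁻ y, ENNReal.ofReal (p x y) ∂b) = μ
  right_eq : b.withDensity (fun y => ∫⁻ x, ENNReal.ofReal (p x y) ∂a) = ν

/-- The measure `p(x,y) a(dx) b(dy)` on the product space. -/
noncomputable def schrodingerCoupling {X Y : Type*} [MeasurableSpace X] [MeasurableSpace Y]
    (p : X → Y → ℝ) (a : Measure X) (b : Measure Y) : Measure (X × Y) :=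
  (a.prod b).withDensity (fun z => ENNReal.ofReal (p z.1 z.2))

/-!
For a positive bounded measurable kernel `p ≤ M`, write candidates for a solution as `a = α μ` and
`b = β ν`. Then `p(x, y) α(x) β(y)` has to be the density, with respect to `μ ⊗ ν`, of a coupling
of `μ` and `ν`. The proof works with the larger class of *sub-couplings* (`IsSubcoupling`), whose
marginals are only bounded above by `μ` and `ν`; the missing mass is the *defect*
(`HasDefectLE`).

The central tool is an energy estimate (`IsSubcoupling.energy_le`). For two pairs
`(α, β)` and `(α', β')` the functions `θ = (α' - α) / (α' + α)` and `η = (β' - β) / (β' + β)` are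
bounded and depend on one variable each, so the integral of `θ + η` against the difference of the
two sub-couplings is at most the sum of their defects, up to a constant. On the other hand, the
integrand is
`2 p (α β - α' β')² / ((α + α') (β + β')) ≥ 0`. When both defects vanish, `α β = α' β'` almost
everywhere, and freezing one variable shows that the pairs differ by a constant factor: this is
uniqueness.

For existence, the truncated systems `α = min N (1 / ∫ p β dν)`, `β = min N (1 / ∫ p α dμ)` are
solved by monotone iteration (`exists_truncatedStep_fixedPoint`), and their defects tend to zero
as `N → ∞` (`exists_isSubcoupling_hasDefectLE`). The products `α(x) β(y)` are bounded above in
probability, uniformly over all sub-couplings, because `p > 0` and the mass is at most one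
(`exists_measureReal_mul_gt_le`). They are also bounded away from zero in probability when
the defect is small, because `p ≤ M` forces the coupling to sit where `α β` is not small
(`exists_measureReal_mul_lt_le`). These bounds control the denominator in the energy estimate after
a suitable rescaling `(κ α', β' / κ)`, so the products are Cauchy in probability as the defects tend
to zero (`exists_measureReal_mul_sub_ge_le`). Along a sequence the products converge almost
everywhere to a positive limit; normalizing at a point makes both factors converge, and the limit
pair has no defect (`exists_isSubcoupling_hasDefectLE_zero`), so that it solves the system.
-/

/-! ### Sub-couplings of product form -/

/-- The function `p(x, y) α(x) β(y)` on the product space. -/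
def scaledKernel {X Y : Type*} (p : X → Y → ℝ) (α : X → ℝ) (β : Y → ℝ) (z : X × Y) : ℝ :=
  p z.1 z.2 * (α z.1 * β z.2)

/-- Positive measurable functions `α`, `β` such that the measure with density `p(x, y) α(x) β(y)`
with respect to `μ ⊗ ν` has marginals bounded above by `μ` and `ν`. -/
structure IsSubcoupling {X Y : Type*} [MeasurableSpace X] [MeasurableSpace Y]
    (p : X → Y → ℝ) (μ : Measure X) (ν : Measure Y) (α : X → ℝ) (β : Y → ℝ) : Prop where
  measurable_left : Measurable α
  measurable_right : Measurable β
  left_pos : ∀ x, 0 < α x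
  right_pos : ∀ y, 0 < β y
  fst_le : ∀ᵐ x ∂μ, ∫⁻ y, ENNReal.ofReal (scaledKernel p α β (x, y)) ∂ν ≤ 1
  snd_le : ∀ᵐ y ∂ν, ∫⁻ x, ENNReal.ofReal (scaledKernel p α β (x, y)) ∂μ ≤ 1

/-- The density `p(x, y) α(x) β(y)` has total mass at least `1 - d`. The mass is written as a
Bochner integral, since the density of a sub-coupling is integrable. -/
def HasDefectLE {X Y : Type*} [MeasurableSpace X] [MeasurableSpace Y]
    (p : X → Y → ℝ) (μ : Measure X) (ν : Measure Y) (α : X → ℝ) (β : Y → ℝ) (d : ℝ) : Prop :=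
  1 - d ≤ ∫ z, scaledKernel p α β z ∂(μ.prod ν)

section Subcoupling

variable {X Y : Type*} {p : X → Y → ℝ} {α α' : X → ℝ} {β β' : Y → ℝ} {d d' : ℝ}

lemma scaledKernel_swap (z : X × Y) :
    scaledKernel (fun y x => p x y) β α z.swap = scaledKernel p α β z := by
  simp only [scaledKernel, Prod.fst_swap, Prod.snd_swap]
  ring

lemma scaledKernel_smul {κ : ℝ} (hκ : 0 < κ) :
    scaledKernel p (fun x => κ * α x) (fun y => β y / κ) = scaledKernel p α β := by
  funext z
  simp only [scaledKernel]
  field_simp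

variable [MeasurableSpace X] [MeasurableSpace Y] {μ : Measure X} {ν : Measure Y}

lemma IsSubcoupling.swap (h : IsSubcoupling p μ ν α β) :
    IsSubcoupling (fun y x => p x y) ν μ β α where
  measurable_left := h.measurable_right
  measurable_right := h.measurable_left
  left_pos := h.right_pos
  right_pos := h.left_pos
  fst_le := by
    filter_upwards [h.snd_le] with y hy
    simpa only [← scaledKernel_swap (p := p) (α := α) (β := β), Prod.swap_prod_mk] using hy
  snd_le := by
    filter_upwards [h.fst_le] with y hy
    simpa only [← scaledKernel_swap (p := p) (α := α) (β := β), Prod.swap_prod_mk] using hy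

lemma IsSubcoupling.smul (h : IsSubcoupling p μ ν α β) {κ : ℝ} (hκ : 0 < κ) :
    IsSubcoupling p μ ν (fun x => κ * α x) (fun y => β y / κ) where
  measurable_left := h.measurable_left.const_mul κ
  measurable_right := h.measurable_right.div_const κ
  left_pos x := mul_pos hκ (h.left_pos x)
  right_pos y := div_pos (h.right_pos y) hκ
  fst_le := by rw [scaledKernel_smul hκ]; exact h.fst_le
  snd_le := by rw [scaledKernel_smul hκ]; exact h.snd_le

lemma HasDefectLE.smul (h : HasDefectLE p μ ν α β d) {κ : ℝ} (hκ : 0 < κ) :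
    HasDefectLE p μ ν (fun x => κ * α x) (fun y => β y / κ) d := by
  unfold HasDefectLE
  rwa [scaledKernel_smul hκ]

lemma IsSubcoupling.measurable (h : IsSubcoupling p μ ν α β)
    (hp : Measurable (Function.uncurry p)) : Measurable (scaledKernel p α β) :=
  Measurable.mul hp ((h.measurable_left.comp measurable_fst).mul
    (h.measurable_right.comp measurable_snd))

lemma IsSubcoupling.measurable_mul (h : IsSubcoupling p μ ν α β) :
    Measurable (fun z : X × Y => α z.1 * β z.2) :=
  (h.measurable_left.comp measurable_fst).mul (h.measurable_right.comp measurable_snd)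

lemma IsSubcoupling.nonneg (h : IsSubcoupling p μ ν α β) (hpos : ∀ x y, 0 < p x y) (z : X × Y) :
    0 ≤ scaledKernel p α β z :=
  (mul_pos (hpos _ _) (mul_pos (h.left_pos _) (h.right_pos _))).le

lemma IsSubcoupling.integral_fst_le (h : IsSubcoupling p μ ν α β)
    (hp : Measurable (Function.uncurry p)) (hpos : ∀ x y, 0 < p x y) :
    ∀ᵐ x ∂μ, ∫ y, scaledKernel p α β (x, y) ∂ν ≤ 1 := by
  filter_upwards [h.fst_le] with x hx
  rw [integral_eq_lintegral_of_nonneg_ae (ae_of_all _ fun y => h.nonneg hpos _)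
    ((h.measurable hp).comp measurable_prodMk_left).aestronglyMeasurable]
  exact ENNReal.toReal_le_of_le_ofReal zero_le_one (by simpa using hx)

variable [IsProbabilityMeasure μ] [IsProbabilityMeasure ν]

lemma integral_scaledKernel_swap :
    ∫ z, scaledKernel (fun y x => p x y) β α z ∂(ν.prod μ)
      = ∫ z, scaledKernel p α β z ∂(μ.prod ν) := by
  rw [← integral_prod_swap]
  simp only [scaledKernel_swap]

lemma HasDefectLE.swap (h : HasDefectLE p μ ν α β d) :
    HasDefectLE (fun y x => p x y) ν μ β α d := by
  unfold HasDefectLE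
  rwa [integral_scaledKernel_swap]

lemma IsSubcoupling.integrable (h : IsSubcoupling p μ ν α β)
    (hp : Measurable (Function.uncurry p)) (hpos : ∀ x y, 0 < p x y) :
    Integrable (scaledKernel p α β) (μ.prod ν) := by
  refine ⟨(h.measurable hp).aestronglyMeasurable, ?_⟩
  rw [hasFiniteIntegral_iff_ofReal (ae_of_all _ (h.nonneg hpos)),
    lintegral_prod _ (h.measurable hp).ennreal_ofReal.aemeasurable]
  calc _ ≤ ∫⁻ _, 1 ∂μ := lintegral_mono_ae h.fst_le
    _ < ∞ := by simp

/-- Two almost-couplings of the same marginals agree, up to their defects, on bounded functions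
of one variable. -/
lemma IsSubcoupling.integral_fst_mul_sub_le (h : IsSubcoupling p μ ν α β)
    (h' : IsSubcoupling p μ ν α' β') (hd : HasDefectLE p μ ν α β d)
    (hd' : HasDefectLE p μ ν α' β' d')
    (hp : Measurable (Function.uncurry p)) (hpos : ∀ x y, 0 < p x y)
    {θ : X → ℝ} (hθ : Measurable θ) (hθ1 : ∀ x, |θ x| ≤ 1) :
    Integrable (fun z => θ z.1 * (scaledKernel p α' β' z - scaledKernel p α β z)) (μ.prod ν) ∧
    ∫ z, θ z.1 * (scaledKernel p α' β' z - scaledKernel p α β z) ∂(μ.prod ν) ≤ d + d' := by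
  have hi := h.integrable hp hpos
  have hi' := h'.integrable hp hpos
  have hint : Integrable
      (fun z : X × Y => θ z.1 * (scaledKernel p α' β' z - scaledKernel p α β z)) (μ.prod ν) :=
    (hi'.sub hi).bdd_mul (hθ.comp measurable_fst).aestronglyMeasurable (c := 1)
      (ae_of_all _ fun z => hθ1 z.1)
  refine ⟨hint, ?_⟩
  unfold HasDefectLE at hd hd'
  rw [integral_prod _ hi] at hd
  rw [integral_prod _ hi'] at hd'
  rw [integral_prod _ hint]
  have hm := hi.integral_prod_left
  have hm' := hi'.integral_prod_left
  have hs : Integrable (fun x => 1 - ∫ y, scaledKernel p α β (x, y) ∂ν) μ :=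
    (integrable_const 1).sub hm
  have hs' : Integrable (fun x => 1 - ∫ y, scaledKernel p α' β' (x, y) ∂ν) μ :=
    (integrable_const 1).sub hm'
  calc _ ≤ ∫ x, ((1 - ∫ y, scaledKernel p α β (x, y) ∂ν)
        + (1 - ∫ y, scaledKernel p α' β' (x, y) ∂ν)) ∂μ := by
        refine integral_mono_ae hint.integral_prod_left (hs.add hs') ?_
        filter_upwards [h.integral_fst_le hp hpos, h'.integral_fst_le hp hpos,
          hi.prod_right_ae, hi'.prod_right_ae] with x h1 h2 h3 h4
        rw [integral_const_mul, integral_sub h4 h3]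
        obtain ⟨h5, h6⟩ := abs_le.1 (hθ1 x)
        nlinarith
    _ = (1 - ∫ x, ∫ y, scaledKernel p α β (x, y) ∂ν ∂μ)
        + (1 - ∫ x, ∫ y, scaledKernel p α' β' (x, y) ∂ν ∂μ) := by
        rw [integral_add hs hs',
          integral_sub (integrable_const 1) hm, integral_sub (integrable_const 1) hm']
        simp
    _ ≤ d + d' := by linarith

/-- The energy estimate. With `θ = (α' - α) / (α' + α)` and `η = (β' - β) / (β' + β)` one has
`(θ + η) (p α' β' - p α β) = 2 p (α β - α' β')² / ((α + α') (β + β'))`, and `θ`, `η` are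
bounded functions of one variable each. -/
lemma IsSubcoupling.energy_le (h : IsSubcoupling p μ ν α β)
    (h' : IsSubcoupling p μ ν α' β') (hd : HasDefectLE p μ ν α β d)
    (hd' : HasDefectLE p μ ν α' β' d')
    (hp : Measurable (Function.uncurry p)) (hpos : ∀ x y, 0 < p x y) :
    Integrable (fun z : X × Y => p z.1 z.2 * (α z.1 * β z.2 - α' z.1 * β' z.2) ^ 2 /
      ((α z.1 + α' z.1) * (β z.2 + β' z.2))) (μ.prod ν) ∧
    ∫ z : X × Y, p z.1 z.2 * (α z.1 * β z.2 - α' z.1 * β' z.2) ^ 2 /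
      ((α z.1 + α' z.1) * (β z.2 + β' z.2)) ∂(μ.prod ν) ≤ d + d' := by
  have hbound : ∀ s t : ℝ, 0 < s → 0 < t → |(t - s) / (t + s)| ≤ 1 := by
    intro s t hs ht
    rw [abs_le, le_div_iff₀ (by linarith), div_le_iff₀ (by linarith)]
    constructor <;> linarith
  obtain ⟨i1, e1⟩ := h.integral_fst_mul_sub_le h' hd hd' hp hpos
    (θ := fun x => (α' x - α x) / (α' x + α x))
    ((h'.measurable_left.sub h.measurable_left).div (h'.measurable_left.add h.measurable_left))
    (fun x => hbound _ _ (h.left_pos x) (h'.left_pos x))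
  obtain ⟨i2, e2⟩ := h.swap.integral_fst_mul_sub_le h'.swap hd.swap hd'.swap
    (hp.comp measurable_swap) (fun y x => hpos x y)
    (θ := fun y => (β' y - β y) / (β' y + β y))
    ((h'.measurable_right.sub h.measurable_right).div
      (h'.measurable_right.add h.measurable_right))
    (fun y => hbound _ _ (h.right_pos y) (h'.right_pos y))
  rw [← integral_prod_swap] at e2
  replace i2 := i2.swap
  simp only [Function.comp_def, scaledKernel_swap, Prod.fst_swap] at e2 i2
  have key : (fun z : X × Y => p z.1 z.2 * (α z.1 * β z.2 - α' z.1 * β' z.2) ^ 2 /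
      ((α z.1 + α' z.1) * (β z.2 + β' z.2))) = fun z => (1 / 2 : ℝ) *
      ((α' z.1 - α z.1) / (α' z.1 + α z.1) * (scaledKernel p α' β' z - scaledKernel p α β z) +
      (β' z.2 - β z.2) / (β' z.2 + β z.2) *
        (scaledKernel p α' β' z - scaledKernel p α β z)) := by
    funext z
    have h1 := h.left_pos z.1
    have h2 := h'.left_pos z.1
    have h3 := h.right_pos z.2
    have h4 := h'.right_pos z.2
    have h5 : α z.1 + α' z.1 ≠ 0 := by positivity
    have h6 : β z.2 + β' z.2 ≠ 0 := by positivity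
    rw [add_comm (α' z.1), add_comm (β' z.2)]
    simp only [scaledKernel]
    field_simp
    ring
  rw [key]
  refine ⟨(i1.add i2).const_mul _, ?_⟩
  rw [integral_const_mul, integral_add i1 i2]
  linarith

end Subcoupling

/-! ### Tightness of the products `α(x) β(y)` -/

/-- A positive measurable function on a finite measure space is bounded away from zero outside
of a set of small measure. -/
lemma exists_pos_measureReal_lt_le {Ω : Type*} [MeasurableSpace Ω] (P : Measure Ω)
    [IsFiniteMeasure P] {f : Ω → ℝ} (hf : Measurable f) (hpos : ∀ ω, 0 < f ω) {δ : ℝ}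
    (hδ : 0 < δ) : ∃ s, 0 < s ∧ P.real {ω | f ω < s} ≤ δ := by
  have hlim : Filter.Tendsto (fun n : ℕ => P {ω | f ω < 1 / ((n : ℝ) + 1)}) Filter.atTop
      (nhds (P (⋂ n : ℕ, {ω | f ω < 1 / ((n : ℝ) + 1)}))) := by
    refine tendsto_measure_iInter_atTop
      (fun n => (measurableSet_lt hf measurable_const).nullMeasurableSet) ?_ ⟨0, measure_ne_top _ _⟩
    intro m n hmn ω hω
    have hω' : f ω < 1 / ((n : ℝ) + 1) := hω
    exact hω'.trans_le (one_div_le_one_div_of_le (by positivity) (by simpa using hmn))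
  have hempty : (⋂ n : ℕ, {ω | f ω < 1 / ((n : ℝ) + 1)}) = ∅ := by
    refine Set.eq_empty_of_forall_notMem fun ω hω => ?_
    obtain ⟨n, hn⟩ := exists_nat_one_div_lt (hpos ω)
    exact lt_asymm hn (Set.mem_iInter.1 hω n)
  rw [hempty, measure_empty] at hlim
  obtain ⟨n, hn⟩ := (hlim.eventually (gt_mem_nhds (ENNReal.ofReal_pos.2 hδ))).exists
  exact ⟨1 / ((n : ℝ) + 1), by positivity, ENNReal.toReal_le_of_le_ofReal hδ.le hn.le⟩

section Tightness

variable {X Y : Type*} [MeasurableSpace X] [MeasurableSpace Y]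
  {μ : Measure X} [IsProbabilityMeasure μ] {ν : Measure Y} [IsProbabilityMeasure ν]
  {p : X → Y → ℝ} {α α' : X → ℝ} {β β' : Y → ℝ} {d d' M : ℝ}

/-- The mass that a sub-coupling gives to a set of first coordinates is at most the `μ`-measure
of that set. -/
lemma IsSubcoupling.integral_indicator_fst_le (h : IsSubcoupling p μ ν α β)
    (hp : Measurable (Function.uncurry p)) (hpos : ∀ x y, 0 < p x y)
    {A : Set X} (hA : MeasurableSet A) :
    Integrable (fun z : X × Y => A.indicator 1 z.1 * scaledKernel p α β z) (μ.prod ν) ∧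
    ∫ z, A.indicator 1 z.1 * scaledKernel p α β z ∂(μ.prod ν) ≤ μ.real A := by
  have hi := h.integrable hp hpos
  have hint : Integrable (fun z : X × Y => A.indicator 1 z.1 * scaledKernel p α β z)
      (μ.prod ν) := by
    refine hi.bdd_mul (c := 1)
      ((measurable_one.indicator hA).comp measurable_fst).aestronglyMeasurable
      (ae_of_all _ fun z => ?_)
    by_cases hz : z.1 ∈ A <;> simp [hz]
  refine ⟨hint, ?_⟩
  rw [integral_prod _ hint, ← integral_indicator_one hA]
  refine integral_mono_ae hint.integral_prod_left
    ((integrable_const (1 : ℝ)).indicator hA) ?_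
  filter_upwards [h.integral_fst_le hp hpos] with x hx
  rw [integral_const_mul]
  by_cases hxA : x ∈ A <;> simp [hxA, hx]

lemma IsSubcoupling.integral_indicator_snd_le (h : IsSubcoupling p μ ν α β)
    (hp : Measurable (Function.uncurry p)) (hpos : ∀ x y, 0 < p x y)
    {B : Set Y} (hB : MeasurableSet B) :
    Integrable (fun z : X × Y => B.indicator 1 z.2 * scaledKernel p α β z) (μ.prod ν) ∧
    ∫ z, B.indicator 1 z.2 * scaledKernel p α β z ∂(μ.prod ν) ≤ ν.real B := by
  obtain ⟨h1, h2⟩ := h.swap.integral_indicator_fst_le (hp.comp measurable_swap)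
    (fun y x => hpos x y) hB
  rw [← integral_prod_swap] at h2
  replace h1 := h1.swap
  simp only [Function.comp_def, scaledKernel_swap, Prod.fst_swap] at h1 h2
  exact ⟨h1, h2⟩

lemma IsSubcoupling.integral_le_one (h : IsSubcoupling p μ ν α β)
    (hp : Measurable (Function.uncurry p)) (hpos : ∀ x y, 0 < p x y) :
    ∫ z, scaledKernel p α β z ∂(μ.prod ν) ≤ 1 := by
  simpa using (h.integral_indicator_fst_le hp hpos MeasurableSet.univ).2

/-- The products `α(x) β(y)` are bounded above in probability, uniformly over all sub-couplings:
this is Markov's inequality, as `p` is positive. -/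
lemma exists_measureReal_mul_gt_le (hp : Measurable (Function.uncurry p))
    (hpos : ∀ x y, 0 < p x y) {δ : ℝ} (hδ : 0 < δ) :
    ∃ C, 0 < C ∧ ∀ (α : X → ℝ) (β : Y → ℝ), IsSubcoupling p μ ν α β →
      (μ.prod ν).real {z | C < α z.1 * β z.2} ≤ δ := by
  obtain ⟨s, hs, hsδ⟩ := exists_pos_measureReal_lt_le (μ.prod ν) hp (fun z => hpos z.1 z.2)
    (half_pos hδ)
  refine ⟨2 / (s * δ), by positivity, fun α β h => ?_⟩
  have hsub : {z : X × Y | 2 / (s * δ) < α z.1 * β z.2} ⊆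
      {z | Function.uncurry p z < s} ∪ {z | 2 / δ ≤ scaledKernel p α β z} := by
    intro z hz
    by_cases hzs : p z.1 z.2 < s
    · exact Or.inl hzs
    · right
      have hz' : 2 / (s * δ) < α z.1 * β z.2 := hz
      calc 2 / δ = s * (2 / (s * δ)) := by field_simp
        _ ≤ p z.1 z.2 * (α z.1 * β z.2) :=
          mul_le_mul (not_lt.1 hzs) hz'.le (by positivity) (hpos _ _).le
  have hmarkov := mul_meas_ge_le_integral_of_nonneg
    (ae_of_all (μ.prod ν) (h.nonneg hpos)) (h.integrable hp hpos) (2 / δ)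
  have h1 := h.integral_le_one hp hpos
  have h2 : (μ.prod ν).real {z | 2 / δ ≤ scaledKernel p α β z} ≤ δ / 2 := by
    have : 2 / δ * (μ.prod ν).real {z | 2 / δ ≤ scaledKernel p α β z} ≤ 1 := hmarkov.trans h1
    rw [div_mul_eq_mul_div, div_le_one hδ] at this
    linarith
  calc _ ≤ _ := measureReal_mono hsub
    _ ≤ _ := measureReal_union_le _ _
    _ ≤ δ := by linarith

/-- Where `α < s` and `β < e` the density is at most `M s e`, so the first coordinates with
`α < s` are mostly coupled to second coordinates with `β ≥ e`. -/
lemma IsSubcoupling.measureReal_left_lt_le (h : IsSubcoupling p μ ν α β)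
    (hd : HasDefectLE p μ ν α β d) (hp : Measurable (Function.uncurry p))
    (hpos : ∀ x y, 0 < p x y) (hM : ∀ x y, p x y ≤ M) {s e : ℝ} (hs : 0 < s) (he : 0 < e) :
    μ.real {x | α x < s} ≤ ν.real {y | e ≤ β y} + d + M * (s * e) := by
  have hA : MeasurableSet {x | s ≤ α x} := measurableSet_le measurable_const h.measurable_left
  have hB : MeasurableSet {y | e ≤ β y} := measurableSet_le measurable_const h.measurable_right
  obtain ⟨i1, e1⟩ := h.integral_indicator_fst_le hp hpos hA
  obtain ⟨i2, e2⟩ := h.integral_indicator_snd_le hp hpos hB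
  have hcompl : μ.real {x | α x < s} = 1 - μ.real {x | s ≤ α x} := by
    rw [← probReal_compl_eq_one_sub hA]
    congr 1
    ext x
    simp
  have hle : ∫ z, scaledKernel p α β z ∂(μ.prod ν) ≤
      ∫ z, ({x | s ≤ α x}.indicator 1 z.1 * scaledKernel p α β z +
        {y | e ≤ β y}.indicator 1 z.2 * scaledKernel p α β z + M * (s * e)) ∂(μ.prod ν) := by
    refine integral_mono (h.integrable hp hpos) ((i1.add i2).add (integrable_const _)) ?_
    intro z
    have hf := h.nonneg hpos z
    have hM0 : 0 < M := (hpos z.1 z.2).trans_le (hM _ _)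
    have hMse : 0 < M * (s * e) := by positivity
    by_cases h1 : s ≤ α z.1 <;> by_cases h2 : e ≤ β z.2 <;> simp [h1, h2] <;> try linarith
    exact mul_le_mul (hM _ _)
      (mul_le_mul (not_le.1 h1).le (not_le.1 h2).le (h.right_pos _).le hs.le)
      (mul_pos (h.left_pos _) (h.right_pos _)).le hM0.le
  have hi12 : Integrable (fun z : X × Y => {x | s ≤ α x}.indicator 1 z.1 * scaledKernel p α β z +
        {y | e ≤ β y}.indicator 1 z.2 * scaledKernel p α β z) (μ.prod ν) := i1.add i2
  rw [integral_add hi12 (integrable_const _), integral_add i1 i2] at hle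
  simp only [integral_const, probReal_univ, one_smul] at hle
  unfold HasDefectLE at hd
  linarith

/-- The products `α(x) β(y)` are bounded away from zero in probability, uniformly over all
sub-couplings of small defect. If `α β` were small with probability `δ`, it would be
small on some rectangle `{α < 2 t} × {β < c / t}` with large sides. As the density is then small on
this rectangle, the coupling has to match these sides with points where `β`, respectively `α`, is
large, and so the product would be too large on another rectangle. -/
lemma exists_measureReal_mul_lt_le (hp : Measurable (Function.uncurry p))
    (hpos : ∀ x y, 0 < p x y) (hM : ∀ x y, p x y ≤ M) {δ : ℝ} (hδ : 0 < δ) :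
    ∃ c, 0 < c ∧ ∃ d, 0 < d ∧ ∀ (α : X → ℝ) (β : Y → ℝ), IsSubcoupling p μ ν α β →
      HasDefectLE p μ ν α β d → (μ.prod ν).real {z | α z.1 * β z.2 < c} ≤ δ := by
  obtain ⟨C, hC, hCδ⟩ := exists_measureReal_mul_gt_le (μ := μ) (ν := ν) hp hpos
    (δ := δ ^ 2 / 32) (by positivity)
  obtain ⟨x₀⟩ : Nonempty X := μ.nonempty_of_neZero
  obtain ⟨y₀⟩ : Nonempty Y := ν.nonempty_of_neZero
  have hM0 : 0 < M := (hpos x₀ y₀).trans_le (hM _ _)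
  -- `c` is chosen such that the product of the thresholds `δ t / (8 M c)` for `α` and
  -- `δ / (16 M t)` for `β` below equals `2 C`
  refine ⟨δ ^ 2 / (256 * M ^ 2 * C), by positivity, δ / 8, by positivity, fun α β h hd => ?_⟩
  set c := δ ^ 2 / (256 * M ^ 2 * C) with hc
  have hc0 : 0 < c := by positivity
  by_contra! hcon
  have hδ1 : δ < 1 := hcon.trans_le measureReal_le_one
  -- a scale `t` at which the distribution function of `α` crosses the level `δ / 2`
  obtain ⟨t, ht, ht1, ht2⟩ : ∃ t, 0 < t ∧ μ.real {x | α x < t} < δ / 2 ∧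
      δ / 2 ≤ μ.real {x | α x < 2 * t} := by
    obtain ⟨s, hs, hs1⟩ := exists_pos_measureReal_lt_le μ h.measurable_left h.left_pos
      (δ := δ / 4) (by positivity)
    obtain ⟨r, hr, hr1⟩ := exists_pos_measureReal_lt_le μ h.measurable_left.inv
      (fun x => inv_pos.2 (h.left_pos x)) (δ := δ / 4) (by positivity)
    have hex : ∃ n : ℕ, δ / 2 ≤ μ.real {x | α x < s * 2 ^ n} := by
      obtain ⟨n, hn⟩ := pow_unbounded_of_one_lt (r⁻¹ / s) (one_lt_two)
      refine ⟨n, ?_⟩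
      rw [div_lt_iff₀ hs] at hn
      have hcompl : {x | α x < s * 2 ^ n}ᶜ ⊆ {x | α⁻¹ x < r} := by
        intro x hx
        have hx' : s * 2 ^ n ≤ α x := by simpa using hx
        exact inv_lt_of_inv_lt₀ hr (by linarith)
      have h1 := measureReal_mono (μ := μ) hcompl
      rw [probReal_compl_eq_one_sub (measurableSet_lt h.measurable_left measurable_const)] at h1
      linarith
    classical
    have hfind := Nat.find_spec hex
    have hmin := fun m => Nat.find_min (m := m) hex
    rcases hN : Nat.find hex with _ | m
    · rw [hN] at hfind
      simp only [pow_zero, mul_one] at hfind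
      linarith
    · rw [hN] at hfind hmin
      refine ⟨s * 2 ^ m, by positivity, not_le.1 (hmin m (Nat.lt_succ_self m)), ?_⟩
      rwa [pow_succ, mul_comm ((2 : ℝ) ^ m) 2, mul_left_comm] at hfind
  have hβ : δ / 2 ≤ ν.real {y | β y < c / t} := by
    have hsub : {z : X × Y | α z.1 * β z.2 < c} ⊆
        ({x | α x < t} ×ˢ Set.univ) ∪ (Set.univ ×ˢ {y | β y < c / t}) := by
      intro z hz
      by_cases hzt : α z.1 < t
      · exact Or.inl ⟨hzt, trivial⟩
      · refine Or.inr ⟨trivial, ?_⟩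
        have hz' : α z.1 * β z.2 < c := hz
        have := mul_le_mul_of_nonneg_right (not_lt.1 hzt) (h.right_pos z.2).le
        simp only [Set.mem_ofPred_eq, lt_div_iff₀ ht]
        linarith
    have h1 := (measureReal_mono (μ := μ.prod ν) hsub).trans (measureReal_union_le _ _)
    simp only [measureReal_prod_prod, probReal_univ, mul_one, one_mul] at h1
    linarith
  -- with these thresholds the density contributes at most `δ / 8` on each of the two sides
  have k1 := h.measureReal_left_lt_le hd hp hpos hM (s := 2 * t) (e := δ / (16 * M * t))
    (by positivity) (by positivity)
  have k2 := h.swap.measureReal_left_lt_le hd.swap (hp.comp measurable_swap)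
    (fun y x => hpos x y) (fun y x => hM x y) (s := c / t) (e := δ * t / (8 * M * c))
    (by positivity) (by positivity)
  have k1' : M * (2 * t * (δ / (16 * M * t))) = δ / 8 := by field_simp; norm_num
  have k2' : M * (c / t * (δ * t / (8 * M * c))) = δ / 8 := by field_simp
  rw [k1'] at k1
  rw [k2'] at k2
  have hrect : ({x | δ * t / (8 * M * c) ≤ α x} ×ˢ {y | δ / (16 * M * t) ≤ β y}) ⊆
      {z : X × Y | C < α z.1 * β z.2} := by
    rintro z ⟨hz1, hz2⟩
    have hz1' : δ * t / (8 * M * c) ≤ α z.1 := hz1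
    have hz2' : δ / (16 * M * t) ≤ β z.2 := hz2
    calc C < δ * t / (8 * M * c) * (δ / (16 * M * t)) := by
          rw [hc]
          field_simp
          norm_num
      _ ≤ α z.1 * β z.2 := mul_le_mul hz1' hz2' (by positivity) (h.left_pos _).le
  have h1 := (measureReal_mono (μ := μ.prod ν) hrect).trans (hCδ α β h)
  rw [measureReal_prod_prod] at h1
  have h2 : δ / 4 * (δ / 4) ≤ μ.real {x | δ * t / (8 * M * c) ≤ α x} *
      ν.real {y | δ / (16 * M * t) ≤ β y} :=
    mul_le_mul (by linarith) (by linarith) (by positivity) measureReal_nonneg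
  nlinarith

/-- Two sub-couplings of small defect have products `α(x) β(y)` that are close in probability.
The energy estimate holds for every rescaling `(κ α', β' / κ)` of the second pair; `κ` is chosen
such that `κ α'` is comparable to `α` on a large set. -/
lemma exists_measureReal_mul_sub_ge_le (hp : Measurable (Function.uncurry p))
    (hpos : ∀ x y, 0 < p x y) (hM : ∀ x y, p x y ≤ M) {ε δ : ℝ} (hε : 0 < ε) (hδ : 0 < δ) :
    ∃ d, 0 < d ∧ ∀ (α α' : X → ℝ) (β β' : Y → ℝ), IsSubcoupling p μ ν α β →
      IsSubcoupling p μ ν α' β' → HasDefectLE p μ ν α β d → HasDefectLE p μ ν α' β' d →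
      (μ.prod ν).real {z | ε ≤ |α z.1 * β z.2 - α' z.1 * β' z.2|} ≤ δ := by
  obtain ⟨C, hC, hCδ⟩ := exists_measureReal_mul_gt_le (μ := μ) (ν := ν) hp hpos
    (δ := δ / 16) (by positivity)
  obtain ⟨c, hc, d₁, hd₁, hcδ⟩ := exists_measureReal_mul_lt_le (μ := μ) (ν := ν) hp hpos hM
    (δ := δ / 16) (by positivity)
  obtain ⟨s, hs, hsδ⟩ := exists_pos_measureReal_lt_le (μ.prod ν) hp (fun z => hpos z.1 z.2)
    (δ := δ / 4) (by positivity)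
  -- a bound for `(α + κ α') (β + β' / κ)` on the good set
  set B : ℝ := 2 * C + 2 * (C * (C / c)) with hB
  have hB0 : 0 < B := by positivity
  -- a lower bound for the energy density where the products differ by at least `ε`
  set η : ℝ := s * ε ^ 2 / B with hη
  have hη0 : 0 < η := by positivity
  refine ⟨min d₁ (η * δ / 8), by positivity, fun α α' β β' h h' hd hd' => ?_⟩
  have hmono : ∀ {α : X → ℝ} {β : Y → ℝ}, HasDefectLE p μ ν α β (min d₁ (η * δ / 8)) →
      HasDefectLE p μ ν α β d₁ := fun {α β} hd =>
    le_trans (sub_le_sub_left (min_le_left _ _) 1) hd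
  -- the bad set
  set G : Set (X × Y) := ({z | C < α z.1 * β z.2} ∪ {z | α z.1 * β z.2 < c}) ∪
    ({z | C < α' z.1 * β' z.2} ∪ {z | α' z.1 * β' z.2 < c}) with hG
  have hGm : MeasurableSet G :=
    ((measurableSet_lt measurable_const h.measurable_mul).union
      (measurableSet_lt h.measurable_mul measurable_const)).union
    ((measurableSet_lt measurable_const h'.measurable_mul).union
      (measurableSet_lt h'.measurable_mul measurable_const))
  have hGδ : (μ.prod ν).real G ≤ δ / 4 := by
    have h1 := measureReal_union_le (μ := μ.prod ν)
      ({z | C < α z.1 * β z.2} ∪ {z | α z.1 * β z.2 < c})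
      ({z | C < α' z.1 * β' z.2} ∪ {z | α' z.1 * β' z.2 < c})
    have h2 := measureReal_union_le (μ := μ.prod ν) {z | C < α z.1 * β z.2}
      {z | α z.1 * β z.2 < c}
    have h3 := measureReal_union_le (μ := μ.prod ν) {z | C < α' z.1 * β' z.2}
      {z | α' z.1 * β' z.2 < c}
    have h4 := hCδ α β h
    have h5 := hCδ α' β' h'
    have h6 := hcδ α β h (hmono hd)
    have h7 := hcδ α' β' h' (hmono hd')
    linarith
  obtain ⟨y₀, hy₀⟩ : ∃ y₀, μ.real ((fun x => (x, y₀)) ⁻¹' G) ≤ δ / 4 := by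
    obtain ⟨y₀, hy₀⟩ := exists_le_lintegral (μ := ν)
      (measurable_measure_prodMk_right (μ := μ) hGm).aemeasurable
    rw [← Measure.prod_apply_symm hGm] at hy₀
    exact ⟨y₀, (ENNReal.toReal_mono (measure_ne_top _ _) hy₀).trans hGδ⟩
  set κ : ℝ := β' y₀ / β y₀ with hκ
  have hκ0 : 0 < κ := div_pos (h'.right_pos _) (h.right_pos _)
  have hdκ : HasDefectLE p μ ν α β (η * δ / 8) :=
    le_trans (sub_le_sub_left (min_le_right _ _) 1) hd
  have hdκ' : HasDefectLE p μ ν α' β' (η * δ / 8) :=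
    le_trans (sub_le_sub_left (min_le_right _ _) 1) hd'
  obtain ⟨iE, eE⟩ := h.energy_le (h'.smul hκ0) hdκ (hdκ'.smul hκ0) hp hpos
  have hmarkov := mul_meas_ge_le_integral_of_nonneg (ae_of_all (μ.prod ν) fun z => ?_) iE η
  swap
  · have h1 := h.left_pos z.1
    have h2 := h'.left_pos z.1
    have h3 := h.right_pos z.2
    have h4 := h'.right_pos z.2
    have h5 := hpos z.1 z.2
    simp only [Pi.zero_apply]
    positivity
  have hEδ := hmarkov.trans eE
  have hEδ' : (μ.prod ν).real {z : X × Y | η ≤ p z.1 z.2 *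
      (α z.1 * β z.2 - κ * α' z.1 * (β' z.2 / κ)) ^ 2 /
      ((α z.1 + κ * α' z.1) * (β z.2 + β' z.2 / κ))} ≤ δ / 4 := by
    rw [← mul_le_mul_iff_right₀ hη0]
    linarith
  have hsub : {z : X × Y | ε ≤ |α z.1 * β z.2 - α' z.1 * β' z.2|} ⊆
      (G ∪ (((fun x => (x, y₀)) ⁻¹' G) ×ˢ Set.univ)) ∪ ({z | Function.uncurry p z < s} ∪
      {z : X × Y | η ≤ p z.1 z.2 *
      (α z.1 * β z.2 - κ * α' z.1 * (β' z.2 / κ)) ^ 2 /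
      ((α z.1 + κ * α' z.1) * (β z.2 + β' z.2 / κ))}) := by
    intro z hz
    by_contra hzn
    simp only [Set.mem_union, not_or, hG, Set.mem_ofPred_eq, not_lt, Set.mem_prod,
      Set.mem_preimage, Set.mem_univ, and_true] at hzn
    obtain ⟨⟨⟨⟨z1, z2⟩, z3, z4⟩, ⟨w1, w2⟩, w3, w4⟩, z5, z6⟩ := hzn
    apply z6
    have a1 := h.left_pos z.1
    have a2 := h'.left_pos z.1
    have a3 := h.right_pos z.2
    have a4 := h'.right_pos z.2
    have b1 := h.right_pos y₀
    have b2 := h'.right_pos y₀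
    have hcancel : κ * α' z.1 * (β' z.2 / κ) = α' z.1 * β' z.2 := by field_simp
    have hpp : s ≤ p z.1 z.2 := z5
    have c1 : κ * α' z.1 ≤ C / c * α z.1 := by
      rw [hκ, div_mul_eq_mul_div, div_le_iff₀ b1, div_mul_eq_mul_div, div_mul_eq_mul_div,
        le_div_iff₀ hc]
      nlinarith
    have c2 : α z.1 ≤ C / c * (κ * α' z.1) := by
      have e : C / c * (κ * α' z.1) = C * (α' z.1 * β' y₀) / (c * β y₀) := by
        rw [hκ]
        field_simp
      rw [e, le_div_iff₀ (by positivity)]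
      nlinarith
    have hden : (α z.1 + κ * α' z.1) * (β z.2 + β' z.2 / κ) ≤ B := by
      have e1 : κ * α' z.1 * β z.2 ≤ C * (C / c) := by
        calc _ ≤ C / c * α z.1 * β z.2 := mul_le_mul_of_nonneg_right c1 a3.le
          _ = C / c * (α z.1 * β z.2) := by ring
          _ ≤ C / c * C := mul_le_mul_of_nonneg_left z1 (by positivity)
          _ = C * (C / c) := by ring
      have e2 : α z.1 * (β' z.2 / κ) ≤ C * (C / c) := by
        calc _ ≤ C / c * (κ * α' z.1) * (β' z.2 / κ) :=
              mul_le_mul_of_nonneg_right c2 (by positivity)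
          _ = C / c * (κ * α' z.1 * (β' z.2 / κ)) := by ring
          _ = C / c * (α' z.1 * β' z.2) := by rw [hcancel]
          _ ≤ C / c * C := mul_le_mul_of_nonneg_left z3 (by positivity)
          _ = C * (C / c) := by ring
      calc _ = α z.1 * β z.2 + κ * α' z.1 * (β' z.2 / κ) + κ * α' z.1 * β z.2 +
            α z.1 * (β' z.2 / κ) := by ring
        _ ≤ B := by rw [hcancel, hB]; linarith
    have hsq : ε ^ 2 ≤ (α z.1 * β z.2 - α' z.1 * β' z.2) ^ 2 := by
      rw [← sq_abs (α z.1 * β z.2 - α' z.1 * β' z.2)]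
      exact pow_le_pow_left₀ hε.le hz 2
    have hp0 := hpos z.1 z.2
    simp only [hcancel]
    exact div_le_div₀ (by positivity) (mul_le_mul hpp hsq (by positivity) (by positivity))
      (by positivity) hden
  have h1 := (measureReal_mono (μ := μ.prod ν) hsub).trans (measureReal_union_le _ _)
  have h2 := measureReal_union_le (μ := μ.prod ν) G (((fun x => (x, y₀)) ⁻¹' G) ×ˢ Set.univ)
  have h3 := measureReal_union_le (μ := μ.prod ν) {z | Function.uncurry p z < s}
    {z : X × Y | η ≤ p z.1 z.2 *
      (α z.1 * β z.2 - κ * α' z.1 * (β' z.2 / κ)) ^ 2 /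
      ((α z.1 + κ * α' z.1) * (β z.2 + β' z.2 / κ))}
  rw [measureReal_prod_prod, probReal_univ, mul_one] at h2
  linarith

end Tightness

/-! ### Sub-couplings of arbitrarily small defect -/

/-- The truncated half-step `x ↦ min N (1 / ∫ q(x, y) b(y) ν(dy))` of the Schrödinger
iteration. -/
noncomputable def truncatedStep {X Y : Type*} [MeasurableSpace Y] (N : ℝ≥0∞)
    (q : X → Y → ℝ≥0∞) (ν : Measure Y) (b : Y → ℝ≥0∞) (x : X) : ℝ≥0∞ :=
  min N (∫⁻ y, q x y * b y ∂ν)⁻¹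

lemma truncatedStep_antitone {X Y : Type*} [MeasurableSpace Y] (N : ℝ≥0∞)
    (q : X → Y → ℝ≥0∞) (ν : Measure Y) : Antitone (truncatedStep N q ν) :=
  fun _ _ hb _ => min_le_min_left _
    (ENNReal.inv_le_inv.2 (lintegral_mono fun y => mul_le_mul_right (hb y) _))

/-- At a fixed point, a first coordinate where the truncation is inactive has full marginal. -/
lemma mul_lintegral_eq_one_of_truncatedStep_lt {X Y : Type*} [MeasurableSpace Y] {ν : Measure Y}
    {N : ℝ≥0∞} {q : X → Y → ℝ≥0∞} {b : Y → ℝ≥0∞}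
    {x : X} (hI : ∫⁻ y, q x y * b y ∂ν ≠ ∞) (hlt : truncatedStep N q ν b x < N) :
    truncatedStep N q ν b x * ∫⁻ y, q x y * b y ∂ν = 1 := by
  unfold truncatedStep at hlt ⊢
  have h1 : (∫⁻ y, q x y * b y ∂ν)⁻¹ < N := (min_lt_iff.1 hlt).resolve_left (lt_irrefl _)
  rw [min_eq_right h1.le, ENNReal.inv_mul_cancel _ hI]
  intro h0
  simp [h0] at h1

section Approximation

variable {X Y : Type*} [MeasurableSpace X] [MeasurableSpace Y]
  {μ : Measure X} {ν : Measure Y}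

lemma measurable_truncatedStep [SFinite ν] {N : ℝ≥0∞} {q : X → Y → ℝ≥0∞}
    (hq : Measurable (Function.uncurry q)) {b : Y → ℝ≥0∞} (hb : Measurable b) :
    Measurable (truncatedStep N q ν b) :=
  measurable_const.min (Measurable.lintegral_prod_right'
    (f := fun z : X × Y => q z.1 z.2 * b z.2) (hq.mul (hb.comp measurable_snd))).inv

lemma truncatedStep_iSup {N : ℝ≥0∞} {q : X → Y → ℝ≥0∞}
    (hq : Measurable (Function.uncurry q)) {b : ℕ → Y → ℝ≥0∞} (hb : ∀ k, Measurable (b k))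
    (hmono : Monotone b) (x : X) :
    truncatedStep N q ν (⨆ k, b k) x = ⨅ k, truncatedStep N q ν (b k) x := by
  simp only [truncatedStep, iSup_apply, ENNReal.mul_iSup]
  have hm : ∀ k, Measurable fun y => q x y * b k y := fun k =>
    (hq.comp measurable_prodMk_left).mul (hb k)
  rw [lintegral_iSup hm (fun i j hij y => mul_le_mul_right (hmono hij y) _),
    ENNReal.inv_iSup, inf_iInf]

lemma truncatedStep_iInf [IsFiniteMeasure ν] {N C : ℝ≥0∞} (hC : C ≠ ∞) {q : X → Y → ℝ≥0∞}
    (hq : Measurable (Function.uncurry q)) (hqC : ∀ x y, q x y ≤ C) {b : ℕ → Y → ℝ≥0∞}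
    (hb : ∀ k, Measurable (b k)) (hbC : ∀ y, b 0 y ≤ C) (hanti : Antitone b) (x : X) :
    truncatedStep N q ν (⨅ k, b k) x = ⨆ k, truncatedStep N q ν (b k) x := by
  have hmul : ∀ y, q x y * ⨅ k, b k y = ⨅ k, q x y * b k y := fun y =>
    ENNReal.mul_iInf' (fun h => absurd (top_le_iff.1 (h ▸ hqC x y)) hC) (fun _ => ⟨0⟩)
  simp only [truncatedStep, iInf_apply, hmul]
  have hm : ∀ k, Measurable fun y => q x y * b k y := fun k =>
    (hq.comp measurable_prodMk_left).mul (hb k)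
  rw [lintegral_iInf hm (fun i j hij y => mul_le_mul_right (hanti hij y) _) ?_,
    ENNReal.inv_iInf, inf_iSup_eq]
  refine ne_top_of_le_ne_top ?_ (lintegral_mono fun y => mul_le_mul' (hqC x y) (hbC y))
  simp [ENNReal.mul_eq_top, hC]

/-- The truncated Schrödinger system is solved by the monotone limit of the iteration started
at zero. -/
lemma exists_truncatedStep_fixedPoint [IsFiniteMeasure μ] [IsFiniteMeasure ν] {N C : ℝ≥0∞}
    (hN : N ≠ ∞) (hC : C ≠ ∞) {q : X → Y → ℝ≥0∞} (hq : Measurable (Function.uncurry q))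
    (hqC : ∀ x y, q x y ≤ C) :
    ∃ (a : X → ℝ≥0∞) (b : Y → ℝ≥0∞), Measurable a ∧ Measurable b ∧
      a = truncatedStep N q ν b ∧ b = truncatedStep N (fun y x => q x y) μ a := by
  have hq' : Measurable (Function.uncurry fun y x => q x y) := hq.comp measurable_swap
  set S := truncatedStep N q ν with hS
  set S' := truncatedStep N (fun y x => q x y) μ with hS'
  have hSm : Monotone fun a => S (S' a) := fun a b hab =>
    truncatedStep_antitone N q ν (truncatedStep_antitone N (fun y x => q x y) μ hab)
  set a : ℕ → X → ℝ≥0∞ := fun k => (fun a => S (S' a))^[k] 0 with ha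
  have hsucc : ∀ k, a (k + 1) = S (S' (a k)) := fun k => Function.iterate_succ_apply' _ _ _
  have hmono : Monotone a := hSm.monotone_iterate_of_le_map (fun _ => zero_le)
  have hmeas : ∀ k, Measurable (a k) := by
    intro k
    induction k with
    | zero => exact measurable_const
    | succ k ih =>
      rw [hsucc]
      exact measurable_truncatedStep hq (measurable_truncatedStep hq' ih)
  have hmeasA : Measurable (⨆ k, a k) := by
    have h := Measurable.iSup (f := a) hmeas
    simpa only [← iSup_apply] using h
  refine ⟨⨆ k, a k, S' (⨆ k, a k), hmeasA, measurable_truncatedStep hq' hmeasA, ?_, rfl⟩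
  have h1 : S' (⨆ k, a k) = ⨅ k, S' (a k) := by
    funext y
    rw [iInf_apply]
    exact truncatedStep_iSup hq' hmeas hmono y
  rw [h1]
  funext x
  rw [hS, truncatedStep_iInf (C := max N C) (by simp [hN, hC]) hq
    (fun x y => (hqC x y).trans (le_max_right _ _))
    (fun k => measurable_truncatedStep hq' (hmeas k))
    (fun y => (min_le_left _ _).trans (le_max_left _ _))
    (fun i j hij => truncatedStep_antitone N _ μ (hmono hij)),
    ← hmono.iSup_nat_add 1, iSup_apply]
  simp only [hsucc, hS, hS']

variable [IsProbabilityMeasure μ] [IsProbabilityMeasure ν] {p : X → Y → ℝ} {M : ℝ}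

lemma IsSubcoupling.one_sub_measureReal_le {α : X → ℝ} {β : Y → ℝ}
    (h : IsSubcoupling p μ ν α β) (hp : Measurable (Function.uncurry p))
    (hpos : ∀ x y, 0 < p x y) {N : ℝ}
    (hfull : ∀ x, α x < N → ∫⁻ y, ENNReal.ofReal (scaledKernel p α β (x, y)) ∂ν = 1) :
    1 - μ.real {x | N ≤ α x} ≤ ∫ z, scaledKernel p α β z ∂(μ.prod ν) := by
  have hA : MeasurableSet {x | N ≤ α x} := measurableSet_le measurable_const h.measurable_left
  have hi := h.integrable hp hpos
  rw [← probReal_compl_eq_one_sub hA, ← integral_indicator_one hA.compl, integral_prod _ hi]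
  refine integral_mono ((integrable_const (1 : ℝ)).indicator hA.compl) hi.integral_prod_left ?_
  intro x
  by_cases hx : α x < N
  · rw [Set.indicator_of_mem (by simpa using hx)]
    simp only
    rw [integral_eq_lintegral_of_nonneg_ae (ae_of_all _ fun y => h.nonneg hpos _)
      ((h.measurable hp).comp measurable_prodMk_left).aestronglyMeasurable, hfull x hx]
    simp
  · rw [Set.indicator_of_notMem (by simpa using hx)]
    exact integral_nonneg fun y => h.nonneg hpos _

/-- Solutions of the truncated systems are sub-couplings with defect tending to zero: the defect
is at most the measure of `{α = N}` and that of `{β = N}`, and on the product of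
these sets `α β = N²`, which is possible only with small probability. -/
lemma exists_isSubcoupling_hasDefectLE (hp : Measurable (Function.uncurry p))
    (hpos : ∀ x y, 0 < p x y) (hM : ∀ x y, p x y ≤ M) {δ : ℝ} (hδ : 0 < δ) :
    ∃ (α : X → ℝ) (β : Y → ℝ), IsSubcoupling p μ ν α β ∧ HasDefectLE p μ ν α β δ := by
  obtain ⟨C, hC, hCδ⟩ := exists_measureReal_mul_gt_le (μ := μ) (ν := ν) hp hpos
    (δ := δ ^ 2 / 2) (by positivity)
  set N : ℝ := C + 1 with hN
  set q : X → Y → ℝ≥0∞ := fun x y => ENNReal.ofReal (p x y) with hq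
  have hqm : Measurable (Function.uncurry q) := hp.ennreal_ofReal
  have hqM : ∀ x y, q x y ≤ ENNReal.ofReal M := fun x y => ENNReal.ofReal_le_ofReal (hM x y)
  obtain ⟨a, b, ham, hbm, hab, hba⟩ := exists_truncatedStep_fixedPoint (μ := μ) (ν := ν)
    (N := ENNReal.ofReal N) ENNReal.ofReal_ne_top (C := ENNReal.ofReal M) ENNReal.ofReal_ne_top
    hqm hqM
  have haN : ∀ x, a x ≤ ENNReal.ofReal N := fun x => by rw [hab]; exact min_le_left _ _
  have hbN : ∀ y, b y ≤ ENNReal.ofReal N := fun y => by rw [hba]; exact min_le_left _ _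
  have hI : ∀ x, ∫⁻ y, q x y * b y ∂ν ≠ ∞ := fun x => by
    refine ne_top_of_le_ne_top ?_ (lintegral_mono fun y => mul_le_mul' (hqM x y) (hbN y))
    simp [ENNReal.mul_eq_top]
  have hJ : ∀ y, ∫⁻ x, q x y * a x ∂μ ≠ ∞ := fun y => by
    refine ne_top_of_le_ne_top ?_ (lintegral_mono fun x => mul_le_mul' (hqM x y) (haN x))
    simp [ENNReal.mul_eq_top]
  have ha0 : ∀ x, 0 < a x := fun x => by
    rw [hab]
    exact lt_min (ENNReal.ofReal_pos.2 (by positivity)) (ENNReal.inv_pos.2 (hI x))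
  have hb0 : ∀ y, 0 < b y := fun y => by
    rw [hba]
    exact lt_min (ENNReal.ofReal_pos.2 (by positivity)) (ENNReal.inv_pos.2 (hJ y))
  have hat : ∀ x, a x ≠ ∞ := fun x => ne_top_of_le_ne_top ENNReal.ofReal_ne_top (haN x)
  have hbt : ∀ y, b y ≠ ∞ := fun y => ne_top_of_le_ne_top ENNReal.ofReal_ne_top (hbN y)
  have hkernel : ∀ x y, ENNReal.ofReal (scaledKernel p (fun x => (a x).toReal)
      (fun y => (b y).toReal) (x, y)) = q x y * (a x * b y) := fun x y => by
    simp only [scaledKernel]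
    rw [ENNReal.ofReal_mul (hpos x y).le, ENNReal.ofReal_mul ENNReal.toReal_nonneg,
      ENNReal.ofReal_toReal (hat x), ENNReal.ofReal_toReal (hbt y)]
  have hfst : ∀ x, ∫⁻ y, ENNReal.ofReal (scaledKernel p (fun x => (a x).toReal)
      (fun y => (b y).toReal) (x, y)) ∂ν = a x * ∫⁻ y, q x y * b y ∂ν := fun x => by
    rw [← lintegral_const_mul' _ _ (hat x)]
    exact lintegral_congr fun y => by rw [hkernel, mul_left_comm]
  have hsnd : ∀ y, ∫⁻ x, ENNReal.ofReal (scaledKernel p (fun x => (a x).toReal)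
      (fun y => (b y).toReal) (x, y)) ∂μ = b y * ∫⁻ x, q x y * a x ∂μ := fun y => by
    rw [← lintegral_const_mul' _ _ (hbt y)]
    exact lintegral_congr fun x => by rw [hkernel]; ring
  have hsub : IsSubcoupling p μ ν (fun x => (a x).toReal) (fun y => (b y).toReal) :=
    { measurable_left := ham.ennreal_toReal
      measurable_right := hbm.ennreal_toReal
      left_pos := fun x => ENNReal.toReal_pos (ha0 x).ne' (hat x)
      right_pos := fun y => ENNReal.toReal_pos (hb0 y).ne' (hbt y)
      fst_le := ae_of_all _ fun x => by
        rw [hfst, hab]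
        exact (mul_le_mul_left (min_le_right _ _) _).trans (ENNReal.inv_mul_le_one _)
      snd_le := ae_of_all _ fun y => by
        rw [hsnd, hba]
        exact (mul_le_mul_left (min_le_right _ _) _).trans (ENNReal.inv_mul_le_one _) }
  refine ⟨_, _, hsub, ?_⟩
  have h1 := hsub.one_sub_measureReal_le hp hpos (N := N) fun x hx => by
    rw [hfst]
    have hx' : a x < ENNReal.ofReal N := (ENNReal.lt_ofReal_iff_toReal_lt (hat x)).2 hx
    rw [hab] at hx' ⊢
    exact mul_lintegral_eq_one_of_truncatedStep_lt (hI x) hx'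
  have h2 := hsub.swap.one_sub_measureReal_le (hp.comp measurable_swap) (fun y x => hpos x y)
    (N := N) fun y hy => by
    have hswap : ∀ x, scaledKernel (fun y x => p x y) (fun y => (b y).toReal)
        (fun x => (a x).toReal) (y, x) = scaledKernel p (fun x => (a x).toReal)
        (fun y => (b y).toReal) (x, y) := fun x => scaledKernel_swap (x, y)
    simp only [hswap, hsnd]
    have hy' : b y < ENNReal.ofReal N := (ENNReal.lt_ofReal_iff_toReal_lt (hbt y)).2 hy
    rw [hba] at hy' ⊢
    exact mul_lintegral_eq_one_of_truncatedStep_lt (hJ y) hy'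
  rw [integral_scaledKernel_swap] at h2
  unfold HasDefectLE
  by_contra! hcon
  have hrect : ({x | N ≤ (a x).toReal} ×ˢ {y | N ≤ (b y).toReal}) ⊆
      {z : X × Y | C < (a z.1).toReal * (b z.2).toReal} := by
    rintro z ⟨hz1, hz2⟩
    have hz1' : N ≤ (a z.1).toReal := hz1
    have hz2' : N ≤ (b z.2).toReal := hz2
    simp only [Set.mem_ofPred_eq]
    nlinarith
  have h3 := (measureReal_mono (μ := μ.prod ν) hrect).trans (hCδ _ _ hsub)
  rw [measureReal_prod_prod] at h3
  have h4 : δ * δ ≤ μ.real {x | N ≤ (a x).toReal} * ν.real {y | N ≤ (b y).toReal} :=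
    mul_le_mul (by linarith) (by linarith) hδ.le measureReal_nonneg
  nlinarith

end Approximation

/-! ### Existence -/

/-- An almost everywhere convergent sequence of measurable functions on a finite measure space
is uniformly bounded outside of a set of small measure. -/
lemma exists_measurableSet_forall_le {Ω : Type*} [MeasurableSpace Ω] (P : Measure Ω)
    [IsFiniteMeasure P] {f : ℕ → Ω → ℝ} (hf : ∀ k, Measurable (f k))
    (hconv : ∀ᵐ ω ∂P, ∃ l, Filter.Tendsto (fun k => f k ω) Filter.atTop (nhds l)) {δ : ℝ}
    (hδ : 0 < δ) :
    ∃ A, MeasurableSet A ∧ P.real Aᶜ ≤ δ ∧ ∃ C, 0 < C ∧ ∀ᵐ ω ∂P, ω ∈ A → ∀ k, f k ω ≤ C := by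
  set g : Ω → ℝ := fun ω => 1 + |⨆ k, f k ω| with hg
  have hgm : Measurable g := by
    have h := Measurable.iSup hf
    exact measurable_const.add (measurable_norm.comp h)
  have hg0 : ∀ ω, 0 < g ω := fun ω => by positivity
  obtain ⟨s, hs, hsδ⟩ := exists_pos_measureReal_lt_le P hgm.inv (fun ω => inv_pos.2 (hg0 ω)) hδ
  refine ⟨{ω | s ≤ g⁻¹ ω}, measurableSet_le measurable_const hgm.inv, ?_, s⁻¹, inv_pos.2 hs, ?_⟩
  · refine le_trans (measureReal_mono ?_) hsδ
    intro ω hω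
    simpa using hω
  · filter_upwards [hconv] with ω ⟨l, hl⟩ hω k
    have h1 : g ω ≤ s⁻¹ := (le_inv_comm₀ hs (hg0 ω)).1 hω
    have h2 := le_ciSup hl.bddAbove_range k
    have h3 := le_abs_self (⨆ k, f k ω)
    simp only [hg] at h1
    linarith

lemma exists_measurable_pos_limit {Ω : Type*} [MeasurableSpace Ω] (P : Measure Ω)
    {f : ℕ → Ω → ℝ} (hf : ∀ k, Measurable (f k))
    (hconv : ∀ᵐ ω ∂P, ∃ l, 0 < l ∧ Filter.Tendsto (fun k => f k ω) Filter.atTop (nhds l)) :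
    ∃ g : Ω → ℝ, Measurable g ∧ (∀ ω, 0 < g ω) ∧
      ∀ᵐ ω ∂P, Filter.Tendsto (fun k => f k ω) Filter.atTop (nhds (g ω)) := by
  obtain ⟨g, hg, hgl⟩ := measurable_limit_of_tendsto_metrizable_ae
    (fun n => (hf n).aemeasurable) (hconv.mono fun ω ⟨l, _, hl⟩ => ⟨l, hl⟩)
  classical
  refine ⟨fun ω => if 0 < g ω then g ω else 1,
    Measurable.ite (measurableSet_lt measurable_const hg) hg measurable_const, fun ω => ?_, ?_⟩
  · dsimp only
    split_ifs with h
    exacts [h, one_pos]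
  · filter_upwards [hconv, hgl] with ω ⟨l, hl0, hl⟩ hω
    rw [if_pos (by rwa [tendsto_nhds_unique hω hl])]
    exact hω

section Existence

variable {X Y : Type*} [MeasurableSpace X] [MeasurableSpace Y]
  {μ : Measure X} [IsProbabilityMeasure μ] {ν : Measure Y} [IsProbabilityMeasure ν]
  {p : X → Y → ℝ} {M : ℝ}

/-- A sequence of sub-couplings with defect tending to zero whose products `α(x) β(y)` converge
almost everywhere to positive limits. -/
lemma exists_seq_isSubcoupling_tendsto_mul (hp : Measurable (Function.uncurry p))
    (hpos : ∀ x y, 0 < p x y) (hM : ∀ x y, p x y ≤ M) :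
    ∃ (α : ℕ → X → ℝ) (β : ℕ → Y → ℝ), (∀ k, IsSubcoupling p μ ν (α k) (β k)) ∧
      (∀ k : ℕ, HasDefectLE p μ ν (α k) (β k) (1 / ((k : ℝ) + 1))) ∧
      ∀ᵐ z ∂(μ.prod ν), ∃ l, 0 < l ∧
        Filter.Tendsto (fun k => α k z.1 * β k z.2) Filter.atTop (nhds l) := by
  choose D hD hDF using fun k : ℕ => exists_measureReal_mul_sub_ge_le (μ := μ) (ν := ν) hp hpos hM
    (ε := (1 / 2) ^ k) (δ := (1 / 2) ^ k) (by positivity) (by positivity)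
  -- defects small enough for consecutive products to be `2⁻ᵏ`-close up to probability `2⁻ᵏ`
  have hE : ∀ k : ℕ, 0 < min (min (D k) (D (k - 1))) (1 / ((k : ℝ) + 1)) := fun k =>
    lt_min (lt_min (hD _) (hD _)) (by positivity)
  choose α β hsub hdef using fun k : ℕ =>
    exists_isSubcoupling_hasDefectLE (μ := μ) (ν := ν) hp hpos hM (hE k)
  have hdef' : ∀ k d, min (min (D k) (D (k - 1))) (1 / ((k : ℝ) + 1)) ≤ d →
      HasDefectLE p μ ν (α k) (β k) d := fun k d hd => le_trans (sub_le_sub_left hd 1) (hdef k)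
  have hdefk : ∀ k : ℕ, HasDefectLE p μ ν (α k) (β k) (1 / ((k : ℝ) + 1)) := fun k =>
    hdef' k _ (min_le_right _ _)
  refine ⟨α, β, hsub, hdefk, ?_⟩
  have hclose : ∀ k, (μ.prod ν).real
      {z | (1 / 2 : ℝ) ^ k ≤ |α k z.1 * β k z.2 - α (k + 1) z.1 * β (k + 1) z.2|} ≤
      (1 / 2) ^ k := fun k =>
    hDF k _ _ _ _ (hsub k) (hsub (k + 1))
      (hdef' k _ ((min_le_left _ _).trans (min_le_left _ _)))
      (hdef' (k + 1) _ ((min_le_left _ _).trans (min_le_right _ _)))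
  have hev : ∀ᵐ z ∂(μ.prod ν), ∀ᶠ k in Filter.atTop,
      z ∉ {z | (1 / 2 : ℝ) ^ k ≤ |α k z.1 * β k z.2 - α (k + 1) z.1 * β (k + 1) z.2|} := by
    refine ae_eventually_notMem (ne_top_of_le_ne_top
      (b := ∑' k : ℕ, ENNReal.ofReal ((1 / 2) ^ k)) ?_ (ENNReal.tsum_le_tsum fun k => ?_))
    · exact summable_geometric_two.tsum_ofReal_ne_top
    · rw [← ofReal_measureReal (measure_ne_top _ _)]
      exact ENNReal.ofReal_le_ofReal (hclose k)
  have hconv : ∀ᵐ z ∂(μ.prod ν), ∃ l,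
      Filter.Tendsto (fun k => α k z.1 * β k z.2) Filter.atTop (nhds l) := by
    filter_upwards [hev] with z hz
    refine cauchySeq_tendsto_of_complete (cauchySeq_of_summable_dist ?_)
    refine Summable.of_norm_bounded_eventually_nat summable_geometric_two ?_
    filter_upwards [hz] with k hk
    simp only [not_le] at hk
    rw [Real.norm_of_nonneg dist_nonneg, Real.dist_eq]
    exact hk.le
  -- the limit vanishes with probability zero because the products are bounded below in probability
  have hzero : (μ.prod ν)
      {z | Filter.Tendsto (fun k => α k z.1 * β k z.2) Filter.atTop (nhds 0)} = 0 := by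
    refine le_antisymm (ENNReal.le_of_forall_pos_le_add fun δ hδ _ => ?_) zero_le
    rw [zero_add]
    obtain ⟨c, hc, d, hd, hcd⟩ := exists_measureReal_mul_lt_le (μ := μ) (ν := ν) hp hpos hM
      (δ := δ) (by exact_mod_cast hδ)
    obtain ⟨m, hm⟩ := exists_nat_one_div_lt hd
    have hmono : Monotone fun n : ℕ => ⋂ k ≥ n + m, {z : X × Y | α k z.1 * β k z.2 < c} := by
      intro i j hij
      exact Set.biInter_mono (fun k hk => le_trans (Nat.add_le_add_right hij m) hk)
        (fun _ _ => le_rfl)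
    calc _ ≤ (μ.prod ν) (⋃ n : ℕ, ⋂ k ≥ n + m, {z : X × Y | α k z.1 * β k z.2 < c}) := by
          refine measure_mono fun z hz => ?_
          obtain ⟨n, hn⟩ := Filter.eventually_atTop.1
            (Filter.Tendsto.eventually_lt_const hc hz)
          simp only [Set.mem_iUnion, Set.mem_iInter]
          exact ⟨n, fun k hk => hn k (le_trans (Nat.le_add_right _ _) hk)⟩
      _ = ⨆ n : ℕ, (μ.prod ν) (⋂ k ≥ n + m, {z : X × Y | α k z.1 * β k z.2 < c}) :=
          hmono.measure_iUnion
      _ ≤ δ := by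
          refine iSup_le fun n => ?_
          have hdn : HasDefectLE p μ ν (α (n + m)) (β (n + m)) d := by
            refine le_trans (sub_le_sub_left ?_ 1) (hdefk (n + m))
            refine le_trans (one_div_le_one_div_of_le (by positivity) ?_) hm.le
            push_cast
            linarith [(Nat.cast_nonneg n : (0 : ℝ) ≤ n)]
          have h1 := hcd _ _ (hsub (n + m)) hdn
          refine (measure_mono (Set.biInter_subset_of_mem (le_refl (n + m)))).trans ?_
          rw [← ofReal_measureReal (measure_ne_top _ _)]
          simpa using ENNReal.ofReal_le_ofReal h1
  filter_upwards [hconv, measure_eq_zero_iff_ae_notMem.1 hzero] with z ⟨l, hl⟩ hz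
  refine ⟨l, lt_of_le_of_ne (ge_of_tendsto' hl fun k =>
    (mul_pos ((hsub k).left_pos _) ((hsub k).right_pos _)).le) ?_, hl⟩
  rintro rfl
  exact hz hl

/-- After rescaling by the value of `β` at a fixed point, both factors converge almost
everywhere. -/
lemma exists_seq_isSubcoupling_tendsto (hp : Measurable (Function.uncurry p))
    (hpos : ∀ x y, 0 < p x y) (hM : ∀ x y, p x y ≤ M) :
    ∃ (α : ℕ → X → ℝ) (β : ℕ → Y → ℝ), (∀ k, IsSubcoupling p μ ν (α k) (β k)) ∧
      (∀ k : ℕ, HasDefectLE p μ ν (α k) (β k) (1 / ((k : ℝ) + 1))) ∧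
      (∀ᵐ x ∂μ, ∃ l, 0 < l ∧ Filter.Tendsto (fun k => α k x) Filter.atTop (nhds l)) ∧
      (∀ᵐ y ∂ν, ∃ l, 0 < l ∧ Filter.Tendsto (fun k => β k y) Filter.atTop (nhds l)) := by
  obtain ⟨α, β, hsub, hdef, hconv⟩ :=
    exists_seq_isSubcoupling_tendsto_mul (μ := μ) (ν := ν) hp hpos hM
  obtain ⟨y₀, hy₀⟩ := (Measure.ae_ae_of_ae_prod
    (Measure.measurePreserving_swap.quasiMeasurePreserving.ae hconv)).exists
  obtain ⟨x₀, hx₀, l₀, hl₀, hlim₀⟩ := ((Measure.ae_ae_of_ae_prod hconv).and hy₀).exists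
  simp only [Prod.swap_prod_mk] at hy₀ hlim₀
  refine ⟨fun k x => β k y₀ * α k x, fun k y => β k y / β k y₀,
    fun k => (hsub k).smul ((hsub k).right_pos y₀),
    fun k => (hdef k).smul ((hsub k).right_pos y₀), ?_, ?_⟩
  · simpa only [mul_comm] using hy₀
  · filter_upwards [hx₀] with y ⟨l, hl, hlim⟩
    refine ⟨l / l₀, div_pos hl hl₀, (hlim.div hlim₀ hl₀.ne').congr fun k => ?_⟩
    exact mul_div_mul_left _ _ ((hsub k).left_pos x₀).ne'

/-- Almost everywhere convergent sub-couplings with vanishing defect have a limit without defect: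
the marginals are controlled by Fatou's lemma and the mass by dominated convergence on large
rectangles on which the factors are bounded. -/
lemma exists_isSubcoupling_hasDefectLE_zero (hp : Measurable (Function.uncurry p))
    (hpos : ∀ x y, 0 < p x y) (hM : ∀ x y, p x y ≤ M) :
    ∃ (α : X → ℝ) (β : Y → ℝ), IsSubcoupling p μ ν α β ∧ HasDefectLE p μ ν α β 0 := by
  obtain ⟨a, b, hsub, hdef, hac, hbc⟩ :=
    exists_seq_isSubcoupling_tendsto (μ := μ) (ν := ν) hp hpos hM
  obtain ⟨α, hα, hα0, hαl⟩ :=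
    exists_measurable_pos_limit μ (fun k => (hsub k).measurable_left) hac
  obtain ⟨β, hβ, hβ0, hβl⟩ := exists_measurable_pos_limit ν (fun k => (hsub k).measurable_right) hbc
  have hker : ∀ x y, Filter.Tendsto (fun k => a k x) Filter.atTop (nhds (α x)) →
      Filter.Tendsto (fun k => b k y) Filter.atTop (nhds (β y)) →
      Filter.Tendsto (fun k => scaledKernel p (a k) (b k) (x, y)) Filter.atTop
        (nhds (scaledKernel p α β (x, y))) := fun x y hx hy => (hx.mul hy).const_mul _
  have hfsub : IsSubcoupling p μ ν α β := by
    refine ⟨hα, hβ, hα0, hβ0, ?_, ?_⟩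
    · filter_upwards [hαl, ae_all_iff.2 fun k => (hsub k).fst_le] with x hx hle
      calc _ = ∫⁻ y, Filter.liminf (fun k => ENNReal.ofReal (scaledKernel p (a k) (b k) (x, y)))
              Filter.atTop ∂ν := by
            refine lintegral_congr_ae ?_
            filter_upwards [hβl] with y hy
            exact ((ENNReal.continuous_ofReal.tendsto _).comp (hker x y hx hy)).liminf_eq.symm
        _ ≤ _ := lintegral_liminf_le fun k =>
            (((hsub k).measurable hp).comp measurable_prodMk_left).ennreal_ofReal
        _ ≤ 1 := Filter.liminf_le_of_le (by isBoundedDefault) fun c hc => by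
            obtain ⟨k, hk⟩ := hc.exists
            exact hk.trans (hle k)
    · filter_upwards [hβl, ae_all_iff.2 fun k => (hsub k).snd_le] with y hy hle
      calc _ = ∫⁻ x, Filter.liminf (fun k => ENNReal.ofReal (scaledKernel p (a k) (b k) (x, y)))
              Filter.atTop ∂μ := by
            refine lintegral_congr_ae ?_
            filter_upwards [hαl] with x hx
            exact ((ENNReal.continuous_ofReal.tendsto _).comp (hker x y hx hy)).liminf_eq.symm
        _ ≤ _ := lintegral_liminf_le fun k =>
            (((hsub k).measurable hp).comp measurable_prodMk_right).ennreal_ofReal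
        _ ≤ 1 := Filter.liminf_le_of_le (by isBoundedDefault) fun c hc => by
            obtain ⟨k, hk⟩ := hc.exists
            exact hk.trans (hle k)
  refine ⟨α, β, hfsub, ?_⟩
  unfold HasDefectLE
  refine le_of_forall_pos_le_add fun ε hε => ?_
  obtain ⟨A, hA, hAε, C, hC, hAC⟩ := exists_measurableSet_forall_le μ
    (fun k => (hsub k).measurable_left) (hαl.mono fun x hx => ⟨_, hx⟩) (half_pos hε)
  obtain ⟨B, hB, hBε, C', hC', hBC⟩ := exists_measurableSet_forall_le ν
    (fun k => (hsub k).measurable_right) (hβl.mono fun x hx => ⟨_, hx⟩) (half_pos hε)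
  have hAB : MeasurableSet (A ×ˢ B) := hA.prod hB
  have haeA : ∀ {q : X → Prop}, (∀ᵐ x ∂μ, q x) → ∀ᵐ z ∂(μ.prod ν), q z.1 := fun h =>
    Measure.quasiMeasurePreserving_fst.ae h
  have haeB : ∀ {q : Y → Prop}, (∀ᵐ y ∂ν, q y) → ∀ᵐ z ∂(μ.prod ν), q z.2 := fun h =>
    Measure.quasiMeasurePreserving_snd.ae h
  have hdct : Filter.Tendsto (fun k => ∫ z in A ×ˢ B, scaledKernel p (a k) (b k) z ∂(μ.prod ν))
      Filter.atTop (nhds (∫ z in A ×ˢ B, scaledKernel p α β z ∂(μ.prod ν))) := by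
    refine tendsto_integral_of_dominated_convergence (fun _ => M * (C * C'))
      (fun k => ((hsub k).measurable hp).aestronglyMeasurable) (integrable_const _)
      (fun k => ?_) ?_
    · refine (ae_restrict_iff' hAB).2 ?_
      filter_upwards [haeA hAC, haeB hBC] with z h1 h2 hz
      rw [Real.norm_of_nonneg ((hsub k).nonneg hpos z)]
      exact mul_le_mul (hM _ _) (mul_le_mul (h1 hz.1 k) (h2 hz.2 k) ((hsub k).right_pos _).le hC.le)
        (mul_pos ((hsub k).left_pos _) ((hsub k).right_pos _)).le
        ((hpos z.1 z.2).le.trans (hM _ _))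
    · refine ae_restrict_of_ae ?_
      filter_upwards [haeA hαl, haeB hβl] with z h1 h2
      exact hker z.1 z.2 h1 h2
  have hlow : ∀ k : ℕ, 1 - 1 / ((k : ℝ) + 1) - ε ≤
      ∫ z in A ×ˢ B, scaledKernel p (a k) (b k) z ∂(μ.prod ν) := by
    intro k
    obtain ⟨i1, e1⟩ := (hsub k).integral_indicator_fst_le hp hpos hA.compl
    obtain ⟨i2, e2⟩ := (hsub k).integral_indicator_snd_le hp hpos hB.compl
    have hi := (hsub k).integrable hp hpos
    have hle : ∫ z, scaledKernel p (a k) (b k) z ∂(μ.prod ν) ≤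
        ∫ z, (((A ×ˢ B).indicator (scaledKernel p (a k) (b k)) z +
          Aᶜ.indicator 1 z.1 * scaledKernel p (a k) (b k) z) +
          Bᶜ.indicator 1 z.2 * scaledKernel p (a k) (b k) z) ∂(μ.prod ν) := by
      refine integral_mono hi (((hi.indicator hAB).add i1).add i2) fun z => ?_
      have hf := (hsub k).nonneg hpos z
      by_cases h1 : z.1 ∈ A <;> by_cases h2 : z.2 ∈ B <;>
        simp [Set.indicator, h1, h2, hf]
    have i3 : Integrable (fun z => (A ×ˢ B).indicator (scaledKernel p (a k) (b k)) z +
          Aᶜ.indicator 1 z.1 * scaledKernel p (a k) (b k) z) (μ.prod ν) :=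
      (hi.indicator hAB).add i1
    rw [integral_add i3 i2, integral_add (hi.indicator hAB) i1, integral_indicator hAB] at hle
    have := hdef k
    unfold HasDefectLE at this
    linarith
  have hfin : 1 - 0 - ε ≤ ∫ z in A ×ˢ B, scaledKernel p α β z ∂(μ.prod ν) :=
    le_of_tendsto_of_tendsto'
      ((tendsto_const_nhds.sub tendsto_one_div_add_atTop_nhds_zero_nat).sub_const ε) hdct hlow
  have := setIntegral_le_integral (s := A ×ˢ B) (hfsub.integrable hp hpos)
    (ae_of_all _ (hfsub.nonneg hpos))
  linarith

lemma IsSubcoupling.lintegral_fst_eq_one {α : X → ℝ} {β : Y → ℝ} (h : IsSubcoupling p μ ν α β)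
    (hd : HasDefectLE p μ ν α β 0) (hp : Measurable (Function.uncurry p))
    (hpos : ∀ x y, 0 < p x y) :
    ∀ᵐ x ∂μ, ∫⁻ y, ENNReal.ofReal (scaledKernel p α β (x, y)) ∂ν = 1 := by
  have hm : Measurable fun x => ∫⁻ y, ENNReal.ofReal (scaledKernel p α β (x, y)) ∂ν :=
    Measurable.lintegral_prod_right' (h.measurable hp).ennreal_ofReal
  have hmass : 1 ≤ ∫⁻ x, ∫⁻ y, ENNReal.ofReal (scaledKernel p α β (x, y)) ∂ν ∂μ := by
    rw [← lintegral_prod _ (h.measurable hp).ennreal_ofReal.aemeasurable,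
      ← ofReal_integral_eq_lintegral_ofReal (h.integrable hp hpos) (ae_of_all _ (h.nonneg hpos))]
    unfold HasDefectLE at hd
    exact ENNReal.one_le_ofReal.2 (by linarith)
  exact ae_eq_of_ae_le_of_lintegral_le h.fst_le
    (ne_top_of_le_ne_top ENNReal.one_ne_top ((lintegral_mono_ae h.fst_le).trans (by simp)))
    aemeasurable_const (by simpa using hmass)

lemma IsSubcoupling.withDensity_left_eq {α : X → ℝ} {β : Y → ℝ} (h : IsSubcoupling p μ ν α β)
    (hd : HasDefectLE p μ ν α β 0) (hp : Measurable (Function.uncurry p))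
    (hpos : ∀ x y, 0 < p x y) :
    (μ.withDensity fun x => ENNReal.ofReal (α x)).withDensity
      (fun x => ∫⁻ y, ENNReal.ofReal (p x y) ∂(ν.withDensity fun y => ENNReal.ofReal (β y))) =
      μ := by
  have hpm : Measurable fun z : X × Y => ENNReal.ofReal (p z.1 z.2) := hp.ennreal_ofReal
  have hpx : ∀ x, Measurable fun y => ENNReal.ofReal (p x y) := fun x =>
    hpm.comp measurable_prodMk_left
  rw [← withDensity_mul μ h.measurable_left.ennreal_ofReal
    (Measurable.lintegral_prod_right' hpm)]
  nth_rw 2 [← withDensity_one (μ := μ)]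
  refine withDensity_congr_ae ?_
  filter_upwards [h.lintegral_fst_eq_one hd hp hpos] with x hx
  rw [Pi.mul_apply,
    lintegral_withDensity_eq_lintegral_mul _ h.measurable_right.ennreal_ofReal (hpx x),
    ← lintegral_const_mul' _ _ ENNReal.ofReal_ne_top,
    Pi.one_apply, ← hx]
  refine lintegral_congr fun y => ?_
  simp only [scaledKernel, Pi.mul_apply]
  rw [ENNReal.ofReal_mul (hpos x y).le, ENNReal.ofReal_mul (h.left_pos x).le]
  ring

/-- The factors of a sub-coupling without defect are the densities of a solution. -/
lemma IsSubcoupling.isSchrodingerSolution {α : X → ℝ} {β : Y → ℝ} (h : IsSubcoupling p μ ν α β)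
    (hd : HasDefectLE p μ ν α β 0) (hp : Measurable (Function.uncurry p))
    (hpos : ∀ x y, 0 < p x y) :
    IsSchrodingerSolution p μ ν (μ.withDensity fun x => ENNReal.ofReal (α x))
      (ν.withDensity fun y => ENNReal.ofReal (β y)) where
  sigmaFinite_left := SigmaFinite.withDensity_ofReal _
  sigmaFinite_right := SigmaFinite.withDensity_ofReal _
  left_eq := h.withDensity_left_eq hd hp hpos
  right_eq := h.swap.withDensity_left_eq hd.swap (hp.comp measurable_swap) fun y x => hpos x y

end Existence

/-! ### Uniqueness -/

section Uniqueness

variable {X Y : Type*} [MeasurableSpace X] [MeasurableSpace Y]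
  {μ : Measure X} {ν : Measure Y} {p : X → Y → ℝ} {a : Measure X} {b : Measure Y}

lemma IsSchrodingerSolution.swap (h : IsSchrodingerSolution p μ ν a b) :
    IsSchrodingerSolution (fun y x => p x y) ν μ b a :=
  ⟨h.sigmaFinite_right, h.sigmaFinite_left, h.right_eq, h.left_eq⟩

lemma withDensity_ofReal_eq_smul {Ω : Type*} [MeasurableSpace Ω] {P : Measure Ω} {f g : Ω → ℝ}
    (hf : Measurable f) (κ : ℝ≥0) (h : ∀ᵐ ω ∂P, g ω = κ * f ω) :
    P.withDensity (fun ω => ENNReal.ofReal (g ω)) =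
      κ • P.withDensity (fun ω => ENNReal.ofReal (f ω)) := by
  rw [← Measure.coe_nnreal_smul, ← withDensity_smul _ hf.ennreal_ofReal]
  refine withDensity_congr_ae ?_
  filter_upwards [h] with ω hω
  rw [hω, ENNReal.ofReal_mul κ.coe_nonneg, ENNReal.ofReal_coe_nnreal]
  rfl

lemma schrodingerCoupling_smul [SFinite a] [SFinite b] {κ : ℝ≥0} (hκ : 0 < κ) :
    schrodingerCoupling p (κ⁻¹ • a) (κ • b) = schrodingerCoupling p a b := by
  unfold schrodingerCoupling
  rw [Measure.prod_smul_left, Measure.prod_smul_right, smul_smul, inv_mul_cancel₀ hκ.ne', one_smul]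

variable [IsProbabilityMeasure μ] [IsProbabilityMeasure ν]

/-- The first component of a solution has a density with respect to `μ`, namely the reciprocal of
`h(x) = ∫ p(x, y) b(dy)`. The value of the density on the `μ`-null set `{h = ∞}` is chosen to be
positive. -/
lemma IsSchrodingerSolution.exists_density_left (h : IsSchrodingerSolution p μ ν a b)
    (hp : Measurable (Function.uncurry p)) (hpos : ∀ x y, 0 < p x y) :
    ∃ α : X → ℝ, Measurable α ∧ (∀ x, 0 < α x) ∧
      a = μ.withDensity (fun x => ENNReal.ofReal (α x)) ∧
      ∀ᵐ x ∂μ, ENNReal.ofReal (α x) * ∫⁻ y, ENNReal.ofReal (p x y) ∂b = 1 := by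
  have hσa := h.sigmaFinite_left
  have hσb := h.sigmaFinite_right
  have hpm : Measurable fun z : X × Y => ENNReal.ofReal (p z.1 z.2) := hp.ennreal_ofReal
  set H : X → ℝ≥0∞ := fun x => ∫⁻ y, ENNReal.ofReal (p x y) ∂b with hH
  have hHm : Measurable H := Measurable.lintegral_prod_right' hpm
  have hb : b ≠ 0 := by
    intro hb
    have h1 := h.right_eq
    rw [hb, withDensity_zero_left] at h1
    exact IsProbabilityMeasure.ne_zero ν h1.symm
  have hH0 : ∀ x, H x ≠ 0 := by
    intro x hx
    have hx' := (lintegral_eq_zero_iff (hpm.comp measurable_prodMk_left)).1 hx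
    have := ae_neBot.2 hb
    obtain ⟨y, hy⟩ := hx'.exists
    exact (ENNReal.ofReal_pos.2 (hpos x y)).ne' hy
  have hleft : a.withDensity H = μ := h.left_eq
  have hHfin : ∀ᵐ x ∂a, H x ≠ ∞ := by
    refine (ae_lt_top hHm ?_).mono fun x hx => hx.ne
    rw [← setLIntegral_univ, ← withDensity_apply _ MeasurableSet.univ, hleft]
    exact measure_ne_top _ _
  have hac : μ ≪ a := hleft ▸ withDensity_absolutelyContinuous a H
  have hinv : a = μ.withDensity fun x => (H x)⁻¹ := by
    rw [← hleft]
    exact (withDensity_inv_same hHm (ae_of_all _ hH0) hHfin).symm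
  have hae : ∀ᵐ x ∂μ, ENNReal.ofReal (if H x = ∞ then 1 else (H x).toReal⁻¹) = (H x)⁻¹ := by
    filter_upwards [hac.ae_le hHfin] with x hx
    rw [if_neg hx, ← ENNReal.toReal_inv, ENNReal.ofReal_toReal (ENNReal.inv_ne_top.2 (hH0 x))]
  refine ⟨fun x => if H x = ∞ then 1 else (H x).toReal⁻¹,
    Measurable.ite (hHm (measurableSet_singleton _)) measurable_const hHm.ennreal_toReal.inv,
    fun x => ?_, ?_, ?_⟩
  · dsimp only
    split_ifs with hx
    exacts [one_pos, inv_pos.2 (ENNReal.toReal_pos (hH0 x) hx)]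
  · rw [withDensity_congr_ae hae]
    exact hinv
  · filter_upwards [hae, hac.ae_le hHfin] with x hx hx'
    rw [hx, ENNReal.inv_mul_cancel (hH0 x) hx']

/-- Solutions of the Schrödinger system are given by sub-couplings without defect. -/
lemma IsSchrodingerSolution.exists_isSubcoupling (h : IsSchrodingerSolution p μ ν a b)
    (hp : Measurable (Function.uncurry p)) (hpos : ∀ x y, 0 < p x y) :
    ∃ (α : X → ℝ) (β : Y → ℝ), IsSubcoupling p μ ν α β ∧ HasDefectLE p μ ν α β 0 ∧
      a = μ.withDensity (fun x => ENNReal.ofReal (α x)) ∧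
      b = ν.withDensity (fun y => ENNReal.ofReal (β y)) := by
  obtain ⟨α, hα, hα0, haα, h1⟩ := h.exists_density_left hp hpos
  obtain ⟨β, hβ, hβ0, hbβ, h2⟩ := h.swap.exists_density_left (hp.comp measurable_swap)
    fun y x => hpos x y
  have hpm : Measurable fun z : X × Y => ENNReal.ofReal (p z.1 z.2) := hp.ennreal_ofReal
  have hpx : ∀ x, Measurable fun y => ENNReal.ofReal (p x y) := fun x =>
    hpm.comp measurable_prodMk_left
  have hpy : ∀ y, Measurable fun x => ENNReal.ofReal (p x y) := fun y =>
    hpm.comp measurable_prodMk_right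
  have hker : ∀ x y, ENNReal.ofReal (scaledKernel p α β (x, y)) =
      ENNReal.ofReal (p x y) * (ENNReal.ofReal (α x) * ENNReal.ofReal (β y)) := fun x y => by
    simp only [scaledKernel]
    rw [ENNReal.ofReal_mul (hpos x y).le, ENNReal.ofReal_mul (hα0 x).le]
  have hfst : ∀ᵐ x ∂μ, ∫⁻ y, ENNReal.ofReal (scaledKernel p α β (x, y)) ∂ν = 1 := by
    filter_upwards [h1] with x hx
    rw [← hx, hbβ, lintegral_withDensity_eq_lintegral_mul _ hβ.ennreal_ofReal (hpx x),
      ← lintegral_const_mul' _ _ ENNReal.ofReal_ne_top]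
    refine lintegral_congr fun y => ?_
    rw [hker, Pi.mul_apply]
    ring
  have hsnd : ∀ᵐ y ∂ν, ∫⁻ x, ENNReal.ofReal (scaledKernel p α β (x, y)) ∂μ = 1 := by
    filter_upwards [h2] with y hy
    rw [← hy, haα, lintegral_withDensity_eq_lintegral_mul _ hα.ennreal_ofReal (hpy y),
      ← lintegral_const_mul' _ _ ENNReal.ofReal_ne_top]
    refine lintegral_congr fun x => ?_
    rw [hker, Pi.mul_apply]
    ring
  have hsub : IsSubcoupling p μ ν α β :=
    ⟨hα, hβ, hα0, hβ0, hfst.mono fun _ hx => hx.le, hsnd.mono fun _ hy => hy.le⟩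
  refine ⟨α, β, hsub, ?_, haα, hbβ⟩
  unfold HasDefectLE
  rw [integral_eq_lintegral_of_nonneg_ae (ae_of_all _ (hsub.nonneg hpos))
    (hsub.measurable hp).aestronglyMeasurable,
    lintegral_prod _ (hsub.measurable hp).ennreal_ofReal.aemeasurable, lintegral_congr_ae hfst]
  simp

/-- Without defects the energy estimate says that the products `α(x) β(y)` agree almost
everywhere. -/
lemma IsSubcoupling.mul_ae_eq {α α' : X → ℝ} {β β' : Y → ℝ} (h : IsSubcoupling p μ ν α β)
    (h' : IsSubcoupling p μ ν α' β') (hd : HasDefectLE p μ ν α β 0)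
    (hd' : HasDefectLE p μ ν α' β' 0) (hp : Measurable (Function.uncurry p))
    (hpos : ∀ x y, 0 < p x y) :
    ∀ᵐ z ∂(μ.prod ν), α z.1 * β z.2 = α' z.1 * β' z.2 := by
  obtain ⟨hi, he⟩ := h.energy_le h' hd hd' hp hpos
  have hden : ∀ z : X × Y, 0 < (α z.1 + α' z.1) * (β z.2 + β' z.2) := fun z =>
    mul_pos (add_pos (h.left_pos _) (h'.left_pos _)) (add_pos (h.right_pos _) (h'.right_pos _))
  have hnn : ∀ z : X × Y, 0 ≤ p z.1 z.2 * (α z.1 * β z.2 - α' z.1 * β' z.2) ^ 2 /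
      ((α z.1 + α' z.1) * (β z.2 + β' z.2)) := fun z =>
    div_nonneg (mul_nonneg (hpos _ _).le (sq_nonneg _)) (hden z).le
  have h0 := (integral_eq_zero_iff_of_nonneg hnn hi).1
    (le_antisymm (by linarith) (integral_nonneg hnn))
  filter_upwards [h0] with z hz
  have hz' : p z.1 z.2 * (α z.1 * β z.2 - α' z.1 * β' z.2) ^ 2 /
      ((α z.1 + α' z.1) * (β z.2 + β' z.2)) = 0 := hz
  rw [div_eq_zero_iff, or_iff_left (hden z).ne', mul_eq_zero, or_iff_right (hpos _ _).ne',
    sq_eq_zero_iff, sub_eq_zero] at hz'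
  exact hz'

lemma IsSchrodingerSolution.exists_smul_eq {a' : Measure X} {b' : Measure Y}
    (h : IsSchrodingerSolution p μ ν a b) (h' : IsSchrodingerSolution p μ ν a' b')
    (hp : Measurable (Function.uncurry p)) (hpos : ∀ x y, 0 < p x y) :
    ∃ κ : ℝ≥0, 0 < κ ∧ a' = κ⁻¹ • a ∧ b' = κ • b := by
  obtain ⟨α, β, hs, hd, rfl, rfl⟩ := h.exists_isSubcoupling hp hpos
  obtain ⟨α', β', hs', hd', rfl, rfl⟩ := h'.exists_isSubcoupling hp hpos
  have hae := hs.mul_ae_eq hs' hd hd' hp hpos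
  obtain ⟨y₀, hy₀⟩ := (Measure.ae_ae_of_ae_prod
    (Measure.measurePreserving_swap.quasiMeasurePreserving.ae hae)).exists
  obtain ⟨x₀, hx₀, hxy⟩ := ((Measure.ae_ae_of_ae_prod hae).and hy₀).exists
  simp only [Prod.fst_swap, Prod.snd_swap] at hy₀ hxy
  have hβ := hs.right_pos y₀
  have hβ' := hs'.right_pos y₀
  have hκ : 0 < β' y₀ / β y₀ := div_pos hβ' hβ
  obtain ⟨κ, hκeq⟩ : ∃ κ : ℝ≥0, (κ : ℝ) = β' y₀ / β y₀ :=
    ⟨_, Real.coe_toNNReal _ hκ.le⟩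
  refine ⟨κ, NNReal.coe_pos.1 (hκeq ▸ hκ), withDensity_ofReal_eq_smul hs.measurable_left _ ?_,
    withDensity_ofReal_eq_smul hs.measurable_right _ ?_⟩
  · filter_upwards [hy₀] with x hx
    rw [NNReal.coe_inv, hκeq]
    field_simp
    linarith
  · filter_upwards [hx₀] with y hy
    rw [hκeq, div_mul_eq_mul_div, eq_div_iff hβ.ne']
    have h1 := hs'.left_pos x₀
    refine mul_left_cancel₀ h1.ne' ?_
    calc α' x₀ * (β' y * β y₀) = α' x₀ * β' y * β y₀ := by ring
      _ = α x₀ * β y₀ * β y := by rw [← hy]; ring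
      _ = α' x₀ * (β' y₀ * β y) := by rw [hxy]; ring

end Uniqueness

theorem mainTheorem2 {X Y : Type*} [TopologicalSpace X] [MeasurableSpace X] [BorelSpace X]
    [MeasurableSpace Y]
    (μ : Measure X) [IsProbabilityMeasure μ] (ν : Measure Y) [IsProbabilityMeasure ν]
    (p : X → Y → ℝ) (hp_meas : Measurable (Function.uncurry p))
    (hp_pos : ∀ x y, 0 < p x y) (hp_bdd : ∃ M : ℝ, ∀ x y, p x y ≤ M)
    (K : Set X) (hK : IsCompact K) (hK_ne : K.Nonempty)
    (hp_cont : ∀ y, ContinuousOn (fun x => p x y) K)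
    (hp_dom : ∃ (J : ℕ) (t : Fin J → X) (c : Fin J → ℝ), (∀ j, 0 < c j) ∧
      ∀ y, sSup ((fun x => p x y) '' K) ≤ ∑ j, c j * p (t j) y) :
    (∃ (a : Measure X) (b : Measure Y), IsSchrodingerSolution p μ ν a b) ∧
    (∀ (a a' : Measure X) (b b' : Measure Y),
      IsSchrodingerSolution p μ ν a b → IsSchrodingerSolution p μ ν a' b' →
        ∃ κ : ℝ≥0, 0 < κ ∧ a' = κ⁻¹ • a ∧ b' = κ • b) ∧
    (∃! π : Measure (X × Y), ∃ (a : Measure X) (b : Measure Y),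
      IsSchrodingerSolution p μ ν a b ∧ π = schrodingerCoupling p a b) := by
  obtain ⟨M, hM⟩ := hp_bdd
  obtain ⟨α, β, hsub, hdef⟩ :=
    exists_isSubcoupling_hasDefectLE_zero (μ := μ) (ν := ν) hp_meas hp_pos hM
  have hsol := hsub.isSchrodingerSolution hdef hp_meas hp_pos
  refine ⟨⟨_, _, hsol⟩, fun a a' b b' h h' => h.exists_smul_eq h' hp_meas hp_pos,
    _, ⟨_, _, hsol, rfl⟩, ?_⟩
  rintro π ⟨a, b, h, rfl⟩
  obtain ⟨κ, hκ, rfl, rfl⟩ := hsol.exists_smul_eq h hp_meas hp_pos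
  exact schrodingerCoupling_smul hκ
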